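/- Let $0<\Omega<\pi$ and let $\theta\in\mathbb{R}$. For $x\in L_\infty(\mathbb{R})$ (complex valued) and a Borel set $D\subset\mathbb{R}$ with non-empty interior, say that $D$ is a spectral gap of $x$ if $\int_{-\infty}^{\infty}x(t)y(t)\,dt=0$ for every complex-valued $y\in L_1(\mathbb{R})$ whose Fourier transform $Y(\omega)=\int_{-\infty}^{\infty}e^{-i\omega t}y(t)\,dt$ vanishes on $\mathbb{R}\setminus D$. Let $\mathcal{V}(\Omega)$ be the set of all $x\in L_\infty(\mathbb{R})$ that have the spectral gap $\mathbb{R}\setminus(-\Omega,\Omega)$. Then every continuous bounded signal $x\in\mathcal{V}(\Omega)$ is uniquely determined, within the class of continuous bounded signals in $\mathcal{V}(\Omega)$, by its one-sided sample $\{x(k)\}_{k\in\mathbb{Z},\,k\le\theta}$: if $x_1,x_2\in\mathcal{V}(\Omega)$ are continuous and bounded and $x_1(k)=x_2(k)$ for all integers $k\le\theta$, then $x_1(t)=x_2(t)$ for all $t\in\mathbb{R}$. -/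

import Mathlib

open MeasureTheory

/-- The (angular-frequency) Fourier transform `Y(ω) = ∫ e^{-iωt} y(t) dt`; it is used for
integrable `y` only. -/
noncomputable def angularFourier (y : ℝ → ℂ) (ω : ℝ) : ℂ :=
  ∫ t : ℝ, Complex.exp (-(Complex.I * (ω : ℂ) * (t : ℂ))) * y t

/-- `D` is a spectral gap of `x ∈ L_∞(ℝ)`: `D` is a Borel set with non-empty interior, and
`∫ x(t) y(t) dt = 0` for every `y ∈ L_1(ℝ)` whose Fourier transform vanishes on `ℝ \ D`. -/
structure HasSpectralGap (x : ℝ → ℂ) (D : Set ℝ) : Prop where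
  measurableSet : MeasurableSet D
  interior_nonempty : (interior D).Nonempty
  memLp_top : MemLp x ⊤ volume
  integral_eq_zero : ∀ y : ℝ → ℂ, Integrable y volume →
    (∀ ω ∈ Dᶜ, angularFourier y ω = 0) → ∫ t : ℝ, x t * y t = 0

/-- The band-limited signals: those with spectral gap `ℝ \ (-Ω, Ω)`. -/
def bandLimited (Ω : ℝ) : Set (ℝ → ℂ) :=
  {x | HasSpectralGap x (Set.Ioo (-Ω) Ω)ᶜ}

/-! Choose `Ω < a < π` and a smooth cutoff `Φ` equal to 1 on the band and supported in frequencies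
`|ω| ≤ a`. The spectral gap forces the difference `x` of the two signals to equal its convolution
with `expKernel Φ`, which is entire, of type `a`, and decays quadratically along horizontal lines.
So `x` extends to an entire `f` with `‖f z‖ ≤ C exp (a |Im z|)` (`exists_entire_extension_of_gap`).

After the reflection `z ↦ ⌊θ⌋ - z`, `f` vanishes on `ℕ`, and Carlson's theorem
(`eq_zero_of_exp_abs_im_of_natCast`) applies: `f z / sin (π z)` is holomorphic on the right
half-plane and is `O(exp (-(π - a)|y|))` on the imaginary axis. That decay pays for a factor `exp
(-c (z + 1) log (z + 1))`, which makes the product decay superexponentially on the positive reals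
while staying bounded on the axis. Phragmén–Lindelöf then makes it zero. -/

/-! ### Paley–Wiener estimates for the kernel. -/

/-- The inverse Fourier transform of `Φ`, at a complex point. -/
noncomputable def expKernel (Φ : ℝ → ℂ) (z : ℂ) : ℂ :=
  ∫ v : ℝ, Φ v * Complex.exp (2 * Real.pi * Complex.I * v * z)

theorem norm_cexp_two_pi_I_mul (v : ℝ) (z : ℂ) :
    ‖Complex.exp (2 * Real.pi * Complex.I * v * z)‖ = Real.exp (-(2 * Real.pi * v * z.im)) := by
  rw [Complex.norm_exp]
  congr 1
  simp [Complex.mul_re, Complex.mul_im]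

theorem norm_mul_cexp_le_of_support {Φ : ℝ → ℂ} {r : ℝ} (hr : tsupport Φ ⊆ Set.Icc (-r) r)
    (v : ℝ) (z : ℂ) :
    ‖Φ v * Complex.exp (2 * Real.pi * Complex.I * v * z)‖
      ≤ ‖Φ v‖ * Real.exp (2 * Real.pi * r * |z.im|) := by
  by_cases h : Φ v = 0
  · simp [h]
  · rw [norm_mul, norm_cexp_two_pi_I_mul]
    have hv := hr (subset_tsupport _ (Function.mem_support.2 h))
    have h1 : |v| ≤ r := abs_le.2 hv
    gcongr
    have h2 : |v * z.im| ≤ r * |z.im| := by rw [abs_mul]; gcongr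
    have h3 := neg_le_abs (v * z.im)
    have := Real.pi_pos
    nlinarith

theorem hasCompactSupport_of_tsupport_subset_Icc {Φ : ℝ → ℂ} {r : ℝ}
    (hr : tsupport Φ ⊆ Set.Icc (-r) r) : HasCompactSupport Φ :=
  isCompact_Icc.of_isClosed_subset (isClosed_tsupport _) hr

theorem integrable_mul_cexp {Φ : ℝ → ℂ} (hΦ : Continuous Φ) (hc : HasCompactSupport Φ) (z : ℂ) :
    Integrable fun v : ℝ => Φ v * Complex.exp (2 * Real.pi * Complex.I * v * z) :=
  Continuous.integrable_of_hasCompactSupport (by fun_prop) hc.mul_right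

theorem norm_expKernel_le {Φ : ℝ → ℂ} {r : ℝ} (hΦ : Continuous Φ)
    (hr : tsupport Φ ⊆ Set.Icc (-r) r) (z : ℂ) :
    ‖expKernel Φ z‖ ≤ (∫ v, ‖Φ v‖) * Real.exp (2 * Real.pi * r * |z.im|) := by
  rw [← integral_mul_const]
  have hc := hasCompactSupport_of_tsupport_subset_Icc hr
  refine norm_integral_le_of_norm_le ?_ (ae_of_all _ fun v => norm_mul_cexp_le_of_support hr v z)
  exact (hΦ.integrable_of_hasCompactSupport hc).norm.mul_const _

theorem hasDerivAt_cexp_two_pi_I_mul (v : ℝ) (z : ℂ) :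
    HasDerivAt (fun v : ℝ => Complex.exp (2 * Real.pi * Complex.I * v * z))
      (2 * Real.pi * Complex.I * z * Complex.exp (2 * Real.pi * Complex.I * v * z)) v := by
  have h := ((Complex.ofRealCLM.hasDerivAt (x := v)).const_mul
    (2 * Real.pi * Complex.I)).mul_const z
  simpa [mul_comm, mul_left_comm] using h.cexp

theorem expKernel_deriv {Φ : ℝ → ℂ} (hΦ : ContDiff ℝ 1 Φ) (hc : HasCompactSupport Φ) (z : ℂ) :
    expKernel (deriv Φ) z = -(2 * Real.pi * Complex.I * z) * expKernel Φ z := by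
  have hd : Continuous (deriv Φ) := hΦ.continuous_deriv le_rfl
  have key := integral_mul_deriv_eq_deriv_mul_of_integrable (u := Φ) (u' := deriv Φ)
    (v := fun v : ℝ => Complex.exp (2 * Real.pi * Complex.I * v * z))
    (v' := fun v : ℝ => 2 * Real.pi * Complex.I * z *
      Complex.exp (2 * Real.pi * Complex.I * v * z))
    (fun v _ => (hΦ.differentiable one_ne_zero v).hasDerivAt)
    (fun v _ => hasDerivAt_cexp_two_pi_I_mul v z)
    (Continuous.integrable_of_hasCompactSupport (by have := hΦ.continuous; fun_prop) hc.mul_right)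
    (Continuous.integrable_of_hasCompactSupport (by fun_prop) hc.deriv.mul_right)
    (Continuous.integrable_of_hasCompactSupport (by have := hΦ.continuous; fun_prop) hc.mul_right)
  simp only [expKernel]
  rw [← neg_eq_iff_eq_neg] at key
  rw [← key, neg_mul, ← integral_const_mul]
  congr 2
  ext v
  ring

/-- Two integrations by parts turn `z ^ 2 * expKernel Φ z` into a multiple of the kernel of `Φ''`.
The quadratic decay makes convolution with a merely bounded signal converge. -/
theorem norm_expKernel_le_div {Φ : ℝ → ℂ} {r : ℝ} (hΦ : ContDiff ℝ 2 Φ)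
    (hr : tsupport Φ ⊆ Set.Icc (-r) r) :
    ∃ C, 0 ≤ C ∧ ∀ z, ‖expKernel Φ z‖
      ≤ C * Real.exp (2 * Real.pi * r * |z.im|) * (1 + ‖z‖ ^ 2)⁻¹ := by
  have hc := hasCompactSupport_of_tsupport_subset_Icc hr
  have hΦ1 : ContDiff ℝ 1 (deriv Φ) :=
    ((contDiff_succ_iff_deriv (n := 1)).1 (by simpa [one_add_one_eq_two] using hΦ)).2.2
  have hr1 : tsupport (deriv Φ) ⊆ Set.Icc (-r) r := tsupport_deriv_subset.trans hr
  have hr2 : tsupport (deriv (deriv Φ)) ⊆ Set.Icc (-r) r := tsupport_deriv_subset.trans hr1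
  refine ⟨(∫ v, ‖Φ v‖) + ∫ v, ‖deriv (deriv Φ) v‖, by positivity, fun z => ?_⟩
  have h0 := norm_expKernel_le hΦ.continuous hr z
  have h2 := norm_expKernel_le (hΦ1.continuous_deriv le_rfl) hr2 z
  rw [expKernel_deriv hΦ1 hc.deriv, expKernel_deriv (hΦ.of_le one_le_two) hc] at h2
  simp only [norm_mul, norm_neg, Complex.norm_ofNat, Complex.norm_real, Complex.norm_I,
    Real.norm_eq_abs, abs_of_pos Real.pi_pos] at h2
  rw [← div_eq_mul_inv, le_div_iff₀ (by positivity)]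
  have h3 : ‖z‖ ^ 2 * ‖expKernel Φ z‖ ≤
      2 * Real.pi * 1 * ‖z‖ * (2 * Real.pi * 1 * ‖z‖ * ‖expKernel Φ z‖) := by
    have hpi : 1 ≤ (2 * Real.pi) ^ 2 := by nlinarith [Real.pi_gt_three]
    have := mul_le_mul_of_nonneg_right hpi (by positivity : 0 ≤ ‖z‖ ^ 2 * ‖expKernel Φ z‖)
    linarith
  nlinarith

theorem hasDerivAt_expKernel {Φ : ℝ → ℂ} {r : ℝ} (hΦ : Continuous Φ)
    (hr : tsupport Φ ⊆ Set.Icc (-r) r) (z : ℂ) :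
    HasDerivAt (expKernel Φ)
      (expKernel (fun v => Φ v * (2 * Real.pi * Complex.I * v)) z) z := by
  have hc := hasCompactSupport_of_tsupport_subset_Icc hr
  have hr' : tsupport (fun v : ℝ => Φ v * (2 * Real.pi * Complex.I * v)) ⊆ Set.Icc (-r) r :=
    (tsupport_mul_subset_left (f := Φ)).trans hr
  rcases lt_or_ge r 0 with hneg | hpos
  · have : Φ = 0 := by
      rw [← tsupport_eq_empty_iff, ← Set.subset_empty_iff]
      exact hr.trans (by rw [Set.Icc_eq_empty (by linarith)])
    subst this
    have h0 : expKernel 0 = fun _ => (0 : ℂ) := by ext; simp [expKernel]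
    rw [h0]
    simpa [expKernel] using hasDerivAt_const z (0 : ℂ)
  refine (hasDerivAt_integral_of_dominated_loc_of_deriv_le (Metric.ball_mem_nhds z one_pos)
    (F := fun z (v : ℝ) => Φ v * Complex.exp (2 * Real.pi * Complex.I * v * z))
    (F' := fun z (v : ℝ) => Φ v * (2 * Real.pi * Complex.I * v) *
      Complex.exp (2 * Real.pi * Complex.I * v * z))
    (bound := fun v => ‖Φ v * (2 * Real.pi * Complex.I * v)‖ *
      Real.exp (2 * Real.pi * r * (|z.im| + 1)))
    (.of_forall fun w => (by fun_prop : Continuous _).aestronglyMeasurable)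
    (integrable_mul_cexp hΦ hc z) (by fun_prop : Continuous _).aestronglyMeasurable
    (ae_of_all _ fun v w hw => ?_) ?_ (ae_of_all _ fun v w _ => ?_)).2
  · refine (norm_mul_cexp_le_of_support hr' v w).trans ?_
    gcongr
    have h1 := (Complex.abs_im_le_norm (w - z)).trans (mem_ball_iff_norm.1 hw).le
    rw [Complex.sub_im] at h1
    have := abs_sub_abs_le_abs_sub w.im z.im
    linarith
  · exact (Continuous.integrable_of_hasCompactSupport (by fun_prop)
      (hasCompactSupport_of_tsupport_subset_Icc hr')).norm.mul_const _
  · have := (((hasDerivAt_id' w).const_mul (2 * Real.pi * Complex.I * v)).cexp).const_mul (Φ v)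
    exact this.congr_deriv (by ring)

/-! ### Convolution of a bounded signal with an entire kernel. -/

theorem integrable_inv_one_add_sub_sq (a : ℝ) : Integrable fun s : ℝ => (1 + (a - s) ^ 2)⁻¹ :=
  integrable_inv_one_add_sq.comp_sub_left a

theorem norm_mul_kernel_sub_le {x : ℝ → ℂ} {K : ℂ → ℂ} {M C a : ℝ}
    (hM : ∀ t, ‖x t‖ ≤ M) (hC : 0 ≤ C)
    (hK : ∀ z, ‖K z‖ ≤ C * Real.exp (a * |z.im|) * (1 + ‖z‖ ^ 2)⁻¹) (z : ℂ) (s : ℝ) :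
    ‖x s * K (z - s)‖ ≤ M * C * Real.exp (a * |z.im|) * (1 + (z.re - s) ^ 2)⁻¹ := by
  have hM0 : 0 ≤ M := (norm_nonneg _).trans (hM 0)
  have h1 := hK (z - s)
  have h2 : (z.re - s) ^ 2 ≤ ‖z - s‖ ^ 2 := by
    rw [← sq_abs]
    gcongr
    simpa using Complex.abs_re_le_norm (z - s)
  rw [norm_mul]
  calc ‖x s‖ * ‖K (z - s)‖
      ≤ M * (C * Real.exp (a * |(z - s).im|) * (1 + ‖z - s‖ ^ 2)⁻¹) := by gcongr; exact hM s
    _ ≤ M * (C * Real.exp (a * |z.im|) * (1 + (z.re - s) ^ 2)⁻¹) := by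
        have : (z - (s : ℂ)).im = z.im := by simp
        rw [this]
        gcongr
    _ = _ := by ring

theorem norm_integral_mul_kernel_sub_le {x : ℝ → ℂ} {K : ℂ → ℂ} {M C a : ℝ}
    (hM : ∀ t, ‖x t‖ ≤ M) (hC : 0 ≤ C)
    (hK : ∀ z, ‖K z‖ ≤ C * Real.exp (a * |z.im|) * (1 + ‖z‖ ^ 2)⁻¹) (z : ℂ) :
    ‖∫ s : ℝ, x s * K (z - s)‖ ≤ M * C * Real.pi * Real.exp (a * |z.im|) := by
  have hint := (integrable_inv_one_add_sub_sq z.re).const_mul (M * C * Real.exp (a * |z.im|))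
  refine (norm_integral_le_of_norm_le hint
    (ae_of_all _ fun s => norm_mul_kernel_sub_le hM hC hK z s)).trans_eq ?_
  rw [integral_const_mul, integral_sub_left_eq_self (fun u : ℝ => (1 + u ^ 2)⁻¹),
    integral_univ_inv_one_add_sq]
  ring

theorem inv_one_add_sq_le_of_abs_sub_le {b c : ℝ} (h : |b - c| ≤ 1) :
    (1 + b ^ 2)⁻¹ ≤ 3 * (1 + c ^ 2)⁻¹ := by
  rw [← div_eq_mul_inv, inv_eq_one_div, div_le_div_iff₀ (by positivity) (by positivity)]
  have := abs_le.1 h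
  nlinarith [sq_nonneg (2 * b - c)]

theorem differentiable_integral_mul_kernel_sub {x : ℝ → ℂ} {K K' : ℂ → ℂ} {M C C' a : ℝ}
    (hx : Continuous x) (hM : ∀ t, ‖x t‖ ≤ M) (hC : 0 ≤ C) (hC' : 0 ≤ C') (ha : 0 ≤ a)
    (hK : ∀ z, ‖K z‖ ≤ C * Real.exp (a * |z.im|) * (1 + ‖z‖ ^ 2)⁻¹)
    (hK' : ∀ z, ‖K' z‖ ≤ C' * Real.exp (a * |z.im|) * (1 + ‖z‖ ^ 2)⁻¹)
    (hd : ∀ z, HasDerivAt K (K' z) z) (hK'c : Continuous K') :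
    Differentiable ℂ fun z => ∫ s : ℝ, x s * K (z - s) := by
  intro z
  have hM0 : 0 ≤ M := (norm_nonneg _).trans (hM 0)
  have hKc : Continuous K := continuous_iff_continuousAt.2 fun z => (hd z).continuousAt
  refine (hasDerivAt_integral_of_dominated_loc_of_deriv_le (Metric.ball_mem_nhds z one_pos)
    (F := fun z (s : ℝ) => x s * K (z - s)) (F' := fun z (s : ℝ) => x s * K' (z - s))
    -- The `+ 1` and the factor 3 absorb the displacement of `w` within the unit ball about `z`.
    (bound := fun s => M * C' * Real.exp (a * (|z.im| + 1)) * (3 * (1 + (z.re - s) ^ 2)⁻¹))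
    (.of_forall fun w => (by fun_prop : Continuous _).aestronglyMeasurable)
    ?_ (by fun_prop : Continuous _).aestronglyMeasurable
    (ae_of_all _ fun s w hw => ?_) ?_ (ae_of_all _ fun s w _ => ?_)).2.differentiableAt
  · exact ((integrable_inv_one_add_sub_sq z.re).const_mul _).mono'
      (by fun_prop : Continuous _).aestronglyMeasurable
      (ae_of_all _ fun s => norm_mul_kernel_sub_le hM hC hK z s)
  · refine (norm_mul_kernel_sub_le hM hC' hK' w s).trans ?_
    have hwz := (mem_ball_iff_norm.1 hw).le
    have h1 := (Complex.abs_im_le_norm (w - z)).trans hwz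
    have h2 := (Complex.abs_re_le_norm (w - z)).trans hwz
    rw [Complex.sub_im] at h1
    rw [Complex.sub_re] at h2
    have h3 := abs_sub_abs_le_abs_sub w.im z.im
    gcongr
    · linarith
    · exact inv_one_add_sq_le_of_abs_sub_le (by simpa using h2)
  · exact ((integrable_inv_one_add_sub_sq z.re).const_mul 3).const_mul _
  · exact ((hd (w - s)).comp_sub_const w (s : ℂ)).const_mul (x s)

/-! ### The reproducing formula. -/

open FourierTransform in
theorem angularFourier_eq_fourier (y : ℝ → ℂ) (ω : ℝ) :
    angularFourier y ω = 𝓕 y (ω / (2 * Real.pi)) := by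
  rw [Real.fourier_eq', angularFourier]
  congr 1
  ext t
  rw [smul_eq_mul]
  congr 2
  have : (Real.pi : ℂ) ≠ 0 := by exact_mod_cast Real.pi_ne_zero
  simp
  field_simp

open FourierTransform in
theorem fourier_eq_expKernel (Φ : ℝ → ℂ) (u : ℝ) : 𝓕 Φ u = expKernel Φ (-u) := by
  rw [Real.fourier_eq', expKernel]
  congr 1
  ext t
  rw [smul_eq_mul, mul_comm]
  congr 2
  simp
  ring

-- For a test function `η`, the transform of `η - η ⋆ 𝓕 Φ` is `𝓕 η ξ * (1 - Φ (-ξ))`, which vanishes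
-- on the symmetric band. The gap and Fubini then give `∫ x η = ∫ η f`, where `f` is the right-hand
-- side.
open FourierTransform Convolution in
theorem eq_integral_mul_expKernel_of_gap {x : ℝ → ℂ} {M Ω : ℝ} {Φ : ℝ → ℂ}
    (hx : Continuous x) (hM : ∀ t, ‖x t‖ ≤ M)
    (hgap : ∀ y : ℝ → ℂ, Integrable y → (∀ ω ∈ Set.Ioo (-Ω) Ω, angularFourier y ω = 0) →
      ∫ t : ℝ, x t * y t = 0)
    (hΦ : Continuous Φ) (hΦi : Integrable Φ) (hΦf : Integrable (𝓕 Φ))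
    (hΦ1 : ∀ ω ∈ Set.Ioo (-Ω) Ω, Φ (ω / (2 * Real.pi)) = 1)
    (hf : Continuous fun t : ℝ => ∫ s : ℝ, x s * expKernel Φ (t - s)) (t : ℝ) :
    x t = ∫ s : ℝ, x s * expKernel Φ (t - s) := by
  set f : ℝ → ℂ := fun t => ∫ s : ℝ, x s * expKernel Φ (t - s) with hfdef
  suffices h : ∀ᵐ t, (x - f) t = 0 by
    have := (Continuous.ae_eq_iff_eq volume (hx.sub hf) continuous_zero).1 h
    exact sub_eq_zero.1 (congrFun this t)
  refine ae_eq_zero_of_integral_contDiff_smul_eq_zero (hx.sub hf).locallyIntegrable ?_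
  intro g hg hgc
  set η : ℝ → ℂ := fun t => (g t : ℂ) with hη
  have hηi : Integrable η :=
    (hg.continuous.integrable_of_hasCompactSupport hgc).ofReal
  set L := ContinuousLinearMap.mul ℂ ℂ with hL
  have hci : Integrable (η ⋆[L] 𝓕 Φ) := hηi.integrable_convolution L hΦf
  have hff : ∀ v, 𝓕 (𝓕 Φ) v = Φ (-v) := by
    intro v
    rw [← congrFun (hΦ.fourierInv_fourier_eq hΦi hΦf) (-v), Real.fourierInv_eq_fourier_neg,
      neg_neg]
  have h0 := hgap (η - η ⋆[L] 𝓕 Φ) (hηi.sub hci) (by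
    intro ω hω
    have h1 : 𝓕 (η - η ⋆[L] 𝓕 Φ) (ω / (2 * Real.pi)) =
        𝓕 η (ω / (2 * Real.pi)) - 𝓕 (η ⋆[L] 𝓕 Φ) (ω / (2 * Real.pi)) := by
      simp only [Real.fourier_eq, Pi.sub_apply, smul_sub]
      exact integral_sub ((Real.fourierIntegral_convergent_iff _).2 hηi)
        ((Real.fourierIntegral_convergent_iff _).2 hci)
    rw [angularFourier_eq_fourier, h1, Real.fourier_mul_convolution_eq hηi hΦf, hff,
      ← neg_div, hΦ1 (-ω) ⟨by linarith [hω.2], by linarith [hω.1]⟩, mul_one, sub_self])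
  have hbx : ∀ᵐ t, ‖x t‖ ≤ M := ae_of_all _ hM
  simp only [Pi.sub_apply, mul_sub] at h0
  rw [integral_sub (hηi.bdd_mul hx.aestronglyMeasurable hbx)
    (hci.bdd_mul hx.aestronglyMeasurable hbx)] at h0
  have hprod : Integrable (fun p : ℝ × ℝ => x p.1 * (η p.2 * 𝓕 Φ (p.1 - p.2)))
      (volume.prod volume) :=
    (hηi.convolution_integrand L hΦf).bdd_mul (c := M)
      (by fun_prop : Continuous fun p : ℝ × ℝ => x p.1).aestronglyMeasurable
      (ae_of_all _ fun p => hM p.1)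
  have hswap : ∫ t, x t * (η ⋆[L] 𝓕 Φ) t = ∫ t, η t * f t := by
    simp only [convolution_def, hL, ContinuousLinearMap.mul_apply', ← integral_const_mul, hfdef]
    rw [integral_integral_swap hprod]
    congr 1
    ext t
    congr 1
    ext s
    rw [fourier_eq_expKernel]
    push_cast
    ring_nf
  have hηf : Integrable fun t => η t * f t :=
    Continuous.integrable_of_hasCompactSupport
      (by have := hg.continuous; fun_prop)
      ((hgc.comp_left (g := fun r : ℝ => (r : ℂ)) (by simp)).mul_right)
  rw [hswap, ← integral_sub (hηi.bdd_mul hx.aestronglyMeasurable hbx) hηf] at h0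
  rw [← h0]
  congr 1
  ext t
  simp [hη]
  ring

/-! ### Division by `sin (π z)`. -/

-- With `w = u + iv`, `‖sin (π w)‖² = sin² (π u) + sinh² (π v)`; Jordan's inequality and `|sinh s| ≥
-- |s|` bound the two terms.
open Real in
theorem two_mul_norm_le_norm_sin_pi_mul {w : ℂ} (hw : |w.re| ≤ 1 / 2) :
    2 * ‖w‖ ≤ ‖Complex.sin (π * w)‖ := by
  rw [← abs_of_nonneg (norm_nonneg w), ← abs_of_nonneg (norm_nonneg (Complex.sin _)),
    ← abs_two (α := ℝ), ← abs_mul, ← sq_le_sq, mul_pow, Complex.sq_norm, Complex.sq_norm,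
    Complex.sin_eq]
  have hre : (π * w).re = π * w.re := by simp
  have him : (π * w).im = π * w.im := by simp
  have h1 : (2 * w.re) ^ 2 ≤ sin (π * w.re) ^ 2 := by
    rw [sq_le_sq]
    have h := Real.mul_abs_le_abs_sin (x := π * w.re) (by
      rw [abs_mul, abs_of_pos pi_pos]; nlinarith [pi_pos])
    rw [abs_mul, abs_of_pos pi_pos] at h
    rw [abs_mul, abs_two]
    have e : 2 / π * (π * |w.re|) = 2 * |w.re| := by field_simp
    rwa [e] at h
  have h2 : (π * w.im) ^ 2 ≤ sinh (π * w.im) ^ 2 := by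
    rw [sq_le_sq, Real.abs_sinh]
    exact Real.self_le_sinh_iff.2 (abs_nonneg _)
  have h3 : (2 * w.im) ^ 2 ≤ (π * w.im) ^ 2 := by
    rw [mul_pow, mul_pow]
    gcongr
    exact Real.two_le_pi
  have e1 := Real.cosh_sq (π * w.im)
  have e2 := Real.sin_sq_add_cos_sq (π * w.re)
  rw [hre, him, ← Complex.ofReal_sin, ← Complex.ofReal_cos, ← Complex.ofReal_sinh,
    ← Complex.ofReal_cosh, ← Complex.ofReal_mul, ← Complex.ofReal_mul, Complex.normSq_add_mul_I,
    Complex.normSq_apply]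
  rw [mul_pow, mul_pow, e1]
  have e3 : cos (π * w.re) ^ 2 = 1 - sin (π * w.re) ^ 2 := by linarith
  rw [e3]
  nlinarith

/-- The quotient `f z / sin (π z)`, with its removable singularities filled in. -/
noncomputable def divSinPi (f : ℂ → ℂ) (z : ℂ) : ℂ :=
  if Complex.sin (Real.pi * z) = 0 then deriv f z / (Real.pi * Complex.cos (Real.pi * z))
  else f z / Complex.sin (Real.pi * z)

theorem sin_pi_mul_eq_zero_iff {z : ℂ} :
    Complex.sin (Real.pi * z) = 0 ↔ ∃ k : ℤ, z = k := by
  rw [Complex.sin_eq_zero_iff]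
  have : (Real.pi : ℂ) ≠ 0 := by exact_mod_cast Real.pi_ne_zero
  refine exists_congr fun k => ?_
  rw [mul_comm, mul_left_inj' this]

theorem norm_cos_of_sin_eq_zero {z : ℂ} (h : Complex.sin z = 0) : ‖Complex.cos z‖ = 1 := by
  have := Complex.sin_sq_add_cos_sq z
  rw [h] at this
  have h2 : ‖Complex.cos z‖ ^ 2 = 1 := by
    rw [zero_pow two_ne_zero, zero_add] at this
    rw [← norm_pow, this, norm_one]
  exact (pow_eq_one_iff_of_nonneg (norm_nonneg _) two_ne_zero).1 h2

theorem hasDerivAt_sin_pi_mul (z : ℂ) :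
    HasDerivAt (fun z : ℂ => Complex.sin (Real.pi * z))
      (Real.pi * Complex.cos (Real.pi * z)) z := by
  have := ((hasDerivAt_id' z).const_mul (Real.pi : ℂ)).csin
  exact this.congr_deriv (by ring)

theorem differentiableAt_divSinPi {f : ℂ → ℂ} (hf : Differentiable ℂ f)
    (h0 : ∀ k : ℕ, f k = 0) {z : ℂ} (hz : -1 < z.re) : DifferentiableAt ℂ (divSinPi f) z := by
  set S : ℂ → ℂ := fun z => Complex.sin (Real.pi * z) with hS
  have hSd : Differentiable ℂ S := fun z => (hasDerivAt_sin_pi_mul z).differentiableAt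
  by_cases h : S z = 0
  · obtain ⟨k, rfl⟩ := sin_pi_mul_eq_zero_iff.1 h
    have hk : 0 ≤ k := by
      have : (-1 : ℝ) < k := by simpa using hz
      have : -1 < k := by exact_mod_cast this
      omega
    have hfk : f k = 0 := by
      lift k to ℕ using hk
      exact_mod_cast h0 k
    have hd : deriv S k ≠ 0 := by
      rw [(hasDerivAt_sin_pi_mul _).deriv]
      refine mul_ne_zero (by exact_mod_cast Real.pi_ne_zero) ?_
      rw [← norm_ne_zero_iff, norm_cos_of_sin_eq_zero h]
      exact one_ne_zero
    have dd : ∀ F : ℂ → ℂ, Differentiable ℂ F → DifferentiableAt ℂ (dslope F k) k := fun F hF =>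
      ((Complex.differentiableOn_dslope Filter.univ_mem).2 hF.differentiableOn).differentiableAt
        Filter.univ_mem
    have hq : DifferentiableAt ℂ (fun w => dslope f k w / dslope S k w) k :=
      (dd f hf).div (dd S hSd) (by rwa [dslope_same])
    -- Near an integer zero the `(w - k)` factors cancel, so the quotient of the two `dslope`s,
    -- analytic at `k`, is `divSinPi f`.
    refine hq.congr_of_eventuallyEq ?_
    filter_upwards [Metric.ball_mem_nhds (k : ℂ) one_pos] with w hw
    rcases eq_or_ne w k with rfl | hne
    · rw [dslope_same, dslope_same, divSinPi, if_pos h, (hasDerivAt_sin_pi_mul _).deriv]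
    · have hw0 : S w ≠ 0 := by
        intro hSw
        obtain ⟨j, rfl⟩ := sin_pi_mul_eq_zero_iff.1 hSw
        rw [mem_ball_iff_norm, ← Int.cast_sub, Complex.norm_intCast, ← Int.cast_abs] at hw
        have : |j - k| < 1 := by exact_mod_cast hw
        exact hne (by rw [sub_eq_zero.1 (Int.abs_lt_one_iff.1 this)])
      rw [dslope_of_ne _ hne, dslope_of_ne _ hne, slope_def_field, slope_def_field, hfk, h,
        sub_zero, sub_zero, divSinPi, if_neg hw0,
        div_div_div_cancel_right₀ (sub_ne_zero.2 hne)]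
  · have hq : DifferentiableAt ℂ (fun w => f w / S w) z := (hf z).div (hSd z) h
    refine hq.congr_of_eventuallyEq ?_
    filter_upwards [hSd.continuous.continuousAt.eventually_ne h] with w hw
    rw [divSinPi, if_neg hw]

theorem norm_deriv_le_of_exp_abs_im {f : ℂ → ℂ} {C a : ℝ} (ha : 0 ≤ a)
    (hf : Differentiable ℂ f) (hC : ∀ z, ‖f z‖ ≤ C * Real.exp (a * |z.im|)) (z : ℂ) :
    ‖deriv f z‖ ≤ C * Real.exp a * Real.exp (a * |z.im|) := by
  have hC0 : 0 ≤ C := by simpa using (norm_nonneg _).trans (hC 0)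
  have := Complex.norm_deriv_le_of_forall_mem_sphere_norm_le (c := z) (f := f)
    (C := C * Real.exp (a * (|z.im| + 1))) one_pos hf.diffContOnCl (by
      intro w hw
      refine (hC w).trans ?_
      have h1 := (Complex.abs_im_le_norm (w - z)).trans (mem_sphere_iff_norm.1 hw).le
      rw [Complex.sub_im] at h1
      have := abs_sub_abs_le_abs_sub w.im z.im
      gcongr
      linarith)
  rw [div_one] at this
  refine this.trans_eq ?_
  rw [mul_assoc, ← Real.exp_add]
  ring_nf

/-- With `k` the integer nearest `z.re`, the mean value inequality gives `‖f z‖ ≤ D ‖z - k‖`, while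
`‖sin (π z)‖ ≥ 2 ‖z - k‖`, so the zeros of the sine cost nothing. -/
theorem norm_divSinPi_le {f : ℂ → ℂ} {C a : ℝ} (ha : 0 ≤ a)
    (hf : Differentiable ℂ f) (hC : ∀ z, ‖f z‖ ≤ C * Real.exp (a * |z.im|))
    (h0 : ∀ k : ℕ, f k = 0) {z : ℂ} (hz : 0 ≤ z.re) :
    ‖divSinPi f z‖ ≤ C * Real.exp a * Real.exp (a * |z.im|) := by
  have hC0 : 0 ≤ C := by simpa using (norm_nonneg _).trans (hC 0)
  set D := C * Real.exp a * Real.exp (a * |z.im|) with hD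
  have hD0 : 0 ≤ D := by positivity
  have hd := norm_deriv_le_of_exp_abs_im ha hf hC
  rw [divSinPi]
  split_ifs with h
  · rw [norm_div, norm_mul, norm_cos_of_sin_eq_zero h, Complex.norm_real, mul_one,
      Real.norm_of_nonneg Real.pi_pos.le]
    refine (div_le_self (norm_nonneg _) ?_).trans (hd z)
    linarith [Real.pi_gt_three]
  · set k := round z.re with hk
    have hkr : |z.re - k| ≤ 1 / 2 := abs_sub_round _
    have hk0 : 0 ≤ k := by
      have h1 := (abs_le.1 hkr).2
      have : (-1 : ℝ) < k := by linarith
      have : -1 < k := by exact_mod_cast this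
      omega
    have hfk : f k = 0 := by
      obtain ⟨n, hn⟩ := Int.eq_ofNat_of_zero_le hk0
      rw [hn]
      exact_mod_cast h0 n
    have hsin : ‖Complex.sin (Real.pi * z)‖ = ‖Complex.sin (Real.pi * (z - k))‖ := by
      rw [mul_sub, mul_comm (Real.pi : ℂ) (k : ℂ), Complex.sin_sub,
        Complex.sin_int_mul_pi, mul_zero, sub_zero, norm_mul,
        norm_cos_of_sin_eq_zero (Complex.sin_int_mul_pi k), mul_one]
    have hne : z - k ≠ 0 := by
      intro hzk
      rw [← ne_eq, ← norm_ne_zero_iff, hsin, hzk] at h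
      simp at h
    have hseg : ‖f z - f k‖ ≤ D * ‖z - k‖ := by
      refine Convex.norm_image_sub_le_of_norm_deriv_le (s := segment ℝ (k : ℂ) z)
        (fun w _ => hf w) (fun w hw => ?_) (convex_segment _ _) (left_mem_segment _ _ _)
        (right_mem_segment _ _ _)
      refine (hd w).trans ?_
      have him : |w.im| ≤ |z.im| := by
        obtain ⟨s, t, hs, ht, hst, rfl⟩ := hw
        simp only [Complex.add_im, Complex.real_smul, Complex.mul_im, Complex.ofReal_re,
          Complex.ofReal_im, Complex.intCast_im, zero_mul, mul_zero, add_zero, zero_add]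
        rw [abs_mul, abs_of_nonneg ht]
        exact mul_le_of_le_one_left (abs_nonneg _) (by linarith)
      rw [hD]
      gcongr
    rw [hfk, sub_zero] at hseg
    have h2 := two_mul_norm_le_norm_sin_pi_mul (w := z - k) (by simpa using hkr)
    rw [norm_div, hsin]
    have hpos : 0 < ‖z - k‖ := norm_pos_iff.2 hne
    rw [div_le_iff₀ (by linarith)]
    nlinarith

/-- The gain `exp (-π |y|)` comes from `sinh (π |y|) ≥ exp (π |y|) / 4` for `|y| ≥ 1`, hence the 4;
the other summand covers `|y| ≤ 1`. -/
theorem norm_divSinPi_mul_I_le {f : ℂ → ℂ} {C a : ℝ} (ha : 0 ≤ a)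
    (hf : Differentiable ℂ f) (hC : ∀ z, ‖f z‖ ≤ C * Real.exp (a * |z.im|))
    (h0 : ∀ k : ℕ, f k = 0) (y : ℝ) :
    ‖divSinPi f (y * Complex.I)‖ ≤
      C * (Real.exp a * Real.exp Real.pi + 4) * Real.exp ((a - Real.pi) * |y|) := by
  have hC0 : 0 ≤ C := by simpa using (norm_nonneg _).trans (hC 0)
  have hpi := Real.pi_gt_three
  have hsplit : Real.exp (a * |y|) =
      Real.exp (Real.pi * |y|) * Real.exp ((a - Real.pi) * |y|) := by
    rw [← Real.exp_add]; ring_nf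
  rcases le_total |y| 1 with hy | hy
  · refine (norm_divSinPi_le ha hf hC h0 (by simp)).trans ?_
    have him : ((y : ℂ) * Complex.I).im = y := by simp
    rw [him, hsplit]
    have h1 : Real.exp (Real.pi * |y|) ≤ Real.exp Real.pi := by
      apply Real.exp_le_exp.2; nlinarith
    calc C * Real.exp a * (Real.exp (Real.pi * |y|) * Real.exp ((a - Real.pi) * |y|))
        ≤ C * Real.exp a * (Real.exp Real.pi * Real.exp ((a - Real.pi) * |y|)) := by gcongr
      _ = C * (Real.exp a * Real.exp Real.pi) * Real.exp ((a - Real.pi) * |y|) := by ring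
      _ ≤ _ := by gcongr; linarith
  · have hnorm : ‖Complex.sin (Real.pi * (y * Complex.I))‖ = Real.sinh (Real.pi * |y|) := by
      rw [← mul_assoc, Complex.sin_mul_I, ← Complex.ofReal_mul, ← Complex.ofReal_sinh, norm_mul,
        Complex.norm_I, mul_one, Complex.norm_real, Real.norm_eq_abs, Real.abs_sinh, abs_mul,
        abs_of_pos Real.pi_pos]
    have hpy : 1 ≤ Real.pi * |y| := by nlinarith
    have hsinh : Real.exp (Real.pi * |y|) / 4 ≤ Real.sinh (Real.pi * |y|) := by
      rw [Real.sinh_eq]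
      have h1 : Real.exp (-(Real.pi * |y|)) ≤ 1 := Real.exp_le_one_iff.2 (by linarith)
      have h2 := Real.add_one_le_exp (Real.pi * |y|)
      linarith
    have hpos : 0 < Real.sinh (Real.pi * |y|) := lt_of_lt_of_le (by positivity) hsinh
    rw [divSinPi, if_neg (by rw [← ne_eq, ← norm_ne_zero_iff, hnorm]; exact hpos.ne'), norm_div,
      hnorm, div_le_iff₀ hpos]
    have h3 := hC (y * Complex.I)
    have him : ((y : ℂ) * Complex.I).im = y := by simp
    rw [him, hsplit] at h3
    refine h3.trans ?_
    have e1 : 0 ≤ Real.exp a * Real.exp Real.pi := by positivity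
    calc C * (Real.exp (Real.pi * |y|) * Real.exp ((a - Real.pi) * |y|))
        = C * 4 * Real.exp ((a - Real.pi) * |y|) * (Real.exp (Real.pi * |y|) / 4) := by ring
      _ ≤ C * (Real.exp a * Real.exp Real.pi + 4) * Real.exp ((a - Real.pi) * |y|) *
          Real.sinh (Real.pi * |y|) := by
        gcongr
        linarith

/-! ### Carlson's theorem by Phragmén–Lindelöf. -/

theorem norm_cexp_neg_mul_log_le (c : ℝ) (hc : 0 ≤ c) (y : ℝ) :
    ‖Complex.exp (-(c * ((y * Complex.I + 1) * Complex.log (y * Complex.I + 1))))‖ ≤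
      Real.exp (c * (Real.pi / 2) * |y|) := by
  set w : ℂ := y * Complex.I + 1 with hw
  have hre : w.re = 1 := by simp [hw]
  have him : w.im = y := by simp [hw]
  rw [Complex.norm_exp]
  apply Real.exp_le_exp.2
  rw [Complex.neg_re, Complex.re_ofReal_mul, Complex.mul_re, hre, him, Complex.log_re,
    Complex.log_im]
  have h1 : 0 ≤ Real.log ‖w‖ := Real.log_nonneg (by
    have := Complex.re_le_norm w; rwa [hre] at this)
  have h2 : |w.arg| ≤ Real.pi / 2 :=
    Complex.abs_arg_le_pi_div_two_iff.2 (by rw [hre]; exact zero_le_one)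
  have h3 : y * w.arg ≤ |y| * (Real.pi / 2) := by
    refine (le_abs_self _).trans ?_
    rw [abs_mul]
    gcongr
  nlinarith

/-- Phragmén–Lindelöf in a half-plane allows growth `exp (B ‖z‖ ^ p)` with `p < 2`; `p = 3 / 2`
leaves room for the logarithm. -/
theorem norm_add_one_mul_log_le {z : ℂ} (hz : 1 ≤ ‖z‖) (hre : 0 < z.re) :
    ‖(z + 1) * Complex.log (z + 1)‖ ≤ 14 * ‖z‖ ^ (3 / 2 : ℝ) := by
  have hw1 : 1 ≤ ‖z + 1‖ := by
    have := Complex.re_le_norm (z + 1)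
    simp at this
    linarith
  have hw2 : ‖z + 1‖ ≤ 2 * ‖z‖ := by
    have := norm_add_le z 1
    simp at this
    linarith
  have hpow : ‖z‖ ^ (3 / 2 : ℝ) = ‖z‖ * √‖z‖ := by
    rw [Real.sqrt_eq_rpow, ← Real.rpow_one_add' (norm_nonneg z) (by norm_num)]
    norm_num
  have hs1 : 1 ≤ √‖z‖ := Real.one_le_sqrt.2 hz
  have hs2 : √‖z + 1‖ ≤ 3 / 2 * √‖z‖ := by
    rw [Real.sqrt_le_left (by positivity), mul_pow, Real.sq_sqrt (norm_nonneg z)]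
    linarith
  have hlog : ‖Complex.log (z + 1)‖ ≤ 7 * √‖z‖ := by
    have h1 := Complex.norm_le_abs_re_add_abs_im (Complex.log (z + 1))
    rw [Complex.log_re, Complex.log_im, abs_of_nonneg (Real.log_nonneg hw1)] at h1
    have h2 := Complex.abs_arg_le_pi (z + 1)
    have h3 : Real.log ‖z + 1‖ ≤ 2 * √‖z + 1‖ := by
      have := Real.log_le_rpow_div (norm_nonneg (z + 1)) (ε := 1 / 2) (by norm_num)
      rw [← Real.sqrt_eq_rpow] at this
      linarith
    have := Real.pi_le_four
    linarith
  rw [norm_mul, hpow]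
  calc ‖z + 1‖ * ‖Complex.log (z + 1)‖ ≤ (2 * ‖z‖) * (7 * √‖z‖) := by gcongr
    _ = _ := by ring

open Filter Asymptotics Bornology in
/-- A case of **Carlson's theorem**: an entire function of exponential type less than `π` on
vertical lines that vanishes at all natural numbers is zero. -/
theorem eq_zero_of_exp_abs_im_of_natCast {f : ℂ → ℂ} {C a : ℝ} (ha : 0 ≤ a) (ha' : a < Real.pi)
    (hf : Differentiable ℂ f) (hC : ∀ z, ‖f z‖ ≤ C * Real.exp (a * |z.im|))
    (h0 : ∀ k : ℕ, f k = 0) : f = 0 := by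
  have hC0 : 0 ≤ C := by simpa using (norm_nonneg _).trans (hC 0)
  -- Chosen so that `c * (π / 2) = π - a`: on the imaginary axis the growth of `E` exactly offsets
  -- the decay of `divSinPi f`.
  set c : ℝ := 2 * (Real.pi - a) / Real.pi with hc
  have hc0 : 0 < c := div_pos (by linarith) Real.pi_pos
  set C' := C * Real.exp a with hC'
  have hC'0 : 0 ≤ C' := by positivity
  -- The shift by 1 keeps the logarithm analytic on the closed half-plane.
  set E : ℂ → ℂ := fun z => Complex.exp (-(c * ((z + 1) * Complex.log (z + 1)))) with hE
  set H : ℂ → ℂ := fun z => divSinPi f z * E z with hH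
  have hg := fun z (hz : (0 : ℝ) ≤ z.re) => norm_divSinPi_le ha hf hC h0 (z := z) hz
  have hzero : Set.EqOn H 0 {z : ℂ | 0 ≤ z.re} := by
    refine PhragmenLindelof.eq_zero_on_right_half_plane_of_superexponential_decay ?_ ?_ ?_ ?_
    · refine DifferentiableOn.diffContOnCl ?_
      rw [Complex.closure_setOfPred_lt_re]
      intro z hz
      have hz' : 0 ≤ z.re := hz
      have hslit : z + 1 ∈ Complex.slitPlane := Or.inl (by simp; linarith)
      refine ((differentiableAt_divSinPi hf h0 (by linarith)).mul ?_).differentiableWithinAt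
      exact ((((differentiableAt_id.add_const 1).mul
        ((differentiableAt_id.add_const 1).clog hslit)).const_mul (c : ℂ)).neg).cexp
    · refine ⟨3 / 2, by norm_num, a + c * 14, IsBigO.of_bound C' ?_⟩
      have hcob : ∀ᶠ z : ℂ in cobounded ℂ ⊓ 𝓟 {z | 0 < z.re}, 1 ≤ ‖z‖ :=
        (tendsto_norm_cobounded_atTop.eventually_ge_atTop 1).filter_mono inf_le_left
      filter_upwards [hcob, mem_inf_of_right (mem_principal_self _)] with z hz hre
      have hre' : 0 < z.re := hre
      rw [hH, norm_mul, Real.norm_of_nonneg (Real.exp_pos _).le]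
      have h1 := hg z hre'.le
      have h2 : ‖E z‖ ≤ Real.exp (c * (14 * ‖z‖ ^ (3 / 2 : ℝ))) := by
        rw [hE, Complex.norm_exp]
        apply Real.exp_le_exp.2
        refine (Complex.re_le_norm _).trans ?_
        rw [norm_neg, norm_mul, Complex.norm_real, Real.norm_of_nonneg hc0.le]
        gcongr
        exact norm_add_one_mul_log_le hz hre'
      have h3 : |z.im| ≤ ‖z‖ ^ (3 / 2 : ℝ) := by
        refine (Complex.abs_im_le_norm z).trans ?_
        exact Real.self_le_rpow_of_one_le hz (by norm_num)
      calc ‖divSinPi f z‖ * ‖E z‖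
          ≤ (C' * Real.exp (a * ‖z‖ ^ (3 / 2 : ℝ))) * Real.exp (c * (14 * ‖z‖ ^ (3 / 2 : ℝ))) := by
            refine mul_le_mul (h1.trans ?_) h2 (norm_nonneg _) (by positivity)
            gcongr
        _ = _ := by rw [mul_assoc, ← Real.exp_add]; ring_nf
    · intro n
      have hlim : Tendsto (fun x : ℝ => C' * Real.exp ((x + 1) * (n - c * Real.log (x + 1))))
          atTop (nhds 0) := by
        rw [← mul_zero C']
        refine (Real.tendsto_exp_atBot.comp ?_).const_mul C'
        have h1 : Tendsto (fun x : ℝ => x + 1) atTop atTop :=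
          tendsto_atTop_add_const_right _ _ tendsto_id
        refine h1.atTop_mul_atBot₀ ?_
        have := (Real.tendsto_log_atTop.comp h1).const_mul_atTop hc0
        exact (tendsto_atBot_add_const_left _ (n : ℝ) (tendsto_neg_atTop_atBot.comp this))
      refine squeeze_zero' (Eventually.of_forall fun x => by positivity) ?_ hlim
      filter_upwards [eventually_ge_atTop 0] with x hx
      have h1 := hg x (by simpa using hx)
      simp only [Complex.ofReal_im, abs_zero, mul_zero, Real.exp_zero, mul_one] at h1
      have h2 : ‖E x‖ = Real.exp (-(c * ((x + 1) * Real.log (x + 1)))) := by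
        rw [hE, Complex.norm_exp]
        have : (x : ℂ) + 1 = ((x + 1 : ℝ) : ℂ) := by push_cast; rfl
        simp only [this]
        rw [← Complex.ofReal_log (by linarith), ← Complex.ofReal_mul, ← Complex.ofReal_mul,
          ← Complex.ofReal_neg, Complex.ofReal_re]
      rw [hH, norm_mul, h2, ← Real.exp_nat_mul]
      calc Real.exp (n * x) *
            (‖divSinPi f x‖ * Real.exp (-(c * ((x + 1) * Real.log (x + 1)))))
          ≤ Real.exp (n * (x + 1)) * (C' * Real.exp (-(c * ((x + 1) * Real.log (x + 1))))) := by
            gcongr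
            linarith
        _ = C' * (Real.exp (n * (x + 1)) * Real.exp (-(c * ((x + 1) * Real.log (x + 1))))) := by
            ring
        _ = _ := by rw [← Real.exp_add]; ring_nf
    · refine ⟨C * (Real.exp a * Real.exp Real.pi + 4), fun y => ?_⟩
      have h1 := norm_divSinPi_mul_I_le ha hf hC h0 y
      have h2 := norm_cexp_neg_mul_log_le c hc0.le y
      have hcpi : c * (Real.pi / 2) = Real.pi - a := by
        rw [hc]; field_simp
      rw [hcpi] at h2
      rw [hH, norm_mul]
      refine (mul_le_mul h1 h2 (norm_nonneg _) (by positivity)).trans_eq ?_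
      have e : (a - Real.pi) * |y| + (Real.pi - a) * |y| = 0 := by ring
      rw [mul_assoc, ← Real.exp_add ((a - Real.pi) * |y|), e, Real.exp_zero, mul_one]
  -- Near `1 + I`, in the half-plane and off the zeros of the sine, `f` vanishes; the identity
  -- theorem does the rest.
  have hana : AnalyticOnNhd ℂ f Set.univ := hf.differentiableOn.analyticOnNhd isOpen_univ
  refine hana.eq_of_eventuallyEq (z₀ := 1 + Complex.I) analyticOnNhd_const ?_
  have hre : ∀ᶠ z in nhds (1 + Complex.I), 0 < z.re :=
    Complex.continuous_re.continuousAt.eventually (lt_mem_nhds (by simp))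
  have him : ∀ᶠ z in nhds (1 + Complex.I), 0 < z.im :=
    Complex.continuous_im.continuousAt.eventually (lt_mem_nhds (by simp))
  filter_upwards [hre, him] with z h1 h2
  have hsin : Complex.sin (Real.pi * z) ≠ 0 := by
    intro h
    obtain ⟨k, rfl⟩ := sin_pi_mul_eq_zero_iff.1 h
    simp at h2
  have h3 : divSinPi f z * E z = 0 := hzero (show z ∈ {z : ℂ | 0 ≤ z.re} from h1.le)
  have h4 := (mul_eq_zero.1 h3).resolve_right (Complex.exp_ne_zero _)
  rw [divSinPi, if_neg hsin] at h4
  exact (div_eq_zero_iff.1 h4).resolve_right hsin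

/-! ### Entire extension of signals and conclusion. -/

theorem Continuous.norm_le_of_memLp_top {x : ℝ → ℂ} (hx : Continuous x)
    (h : MemLp x ⊤ volume) : ∃ M, ∀ t, ‖x t‖ ≤ M := by
  have htop : eLpNormEssSup x volume ≠ ⊤ := by
    rw [← eLpNorm_exponent_top]; exact h.eLpNorm_ne_top
  refine ⟨(eLpNormEssSup x volume).toReal, fun t => ?_⟩
  have hopen : IsOpen {t | (eLpNormEssSup x volume).toReal < ‖x t‖} :=
    isOpen_lt continuous_const hx.norm
  have hnull : volume {t | (eLpNormEssSup x volume).toReal < ‖x t‖} = 0 := by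
    have hae : ∀ᵐ t, ‖x t‖ ≤ (eLpNormEssSup x volume).toReal := by
      filter_upwards [ae_le_eLpNormEssSup (f := x) (μ := volume)] with t ht
      simpa using ENNReal.toReal_mono htop ht
    simpa [ae_iff] using hae
  by_contra! ht
  exact (hopen.eq_empty_of_measure_zero hnull).subset ht

open FourierTransform in
/-- Bounded continuous functions with the spectral gap `ℝ \ (-Ω, Ω)` are restrictions of entire
functions of exponential type. -/
theorem exists_entire_extension_of_gap {x : ℝ → ℂ} {M Ω a : ℝ} (hΩ : 0 < Ω) (ha : Ω < a)
    (hx : Continuous x) (hM : ∀ t, ‖x t‖ ≤ M)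
    (hgap : ∀ y : ℝ → ℂ, Integrable y → (∀ ω ∈ Set.Ioo (-Ω) Ω, angularFourier y ω = 0) →
      ∫ t : ℝ, x t * y t = 0) :
    ∃ f : ℂ → ℂ, Differentiable ℂ f ∧ (∃ C, ∀ z, ‖f z‖ ≤ C * Real.exp (a * |z.im|)) ∧
      ∀ t : ℝ, f t = x t := by
  have hpi : 0 < 2 * Real.pi := by positivity
  set r := a / (2 * Real.pi) with hr
  have hra : 2 * Real.pi * r = a := by rw [hr]; field_simp
  -- The radii are divided by `2π` because `𝓕` uses ordinary rather than angular frequency.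
  let b : ContDiffBump (0 : ℝ) := ⟨Ω / (2 * Real.pi), r, by positivity, by rw [hr]; gcongr⟩
  set Φ : ℝ → ℂ := fun v => (b v : ℂ) with hΦ
  have hΦs : ContDiff ℝ (⊤ : ℕ∞) Φ := Complex.ofRealCLM.contDiff.comp b.contDiff
  have hsupp : tsupport Φ ⊆ Set.Icc (-r) r := by
    have h1 : tsupport Φ ⊆ tsupport b :=
      closure_mono fun v hv => by
        simp only [hΦ, Function.mem_support] at hv ⊢
        exact_mod_cast hv
    rw [b.tsupport_eq, Real.closedBall_eq_Icc] at h1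
    simpa using h1
  have hcs := hasCompactSupport_of_tsupport_subset_Icc hsupp
  have hsupp' : tsupport (fun v : ℝ => Φ v * (2 * Real.pi * Complex.I * v)) ⊆ Set.Icc (-r) r :=
    (tsupport_mul_subset_left (f := Φ)).trans hsupp
  have hΦs' : ContDiff ℝ (⊤ : ℕ∞) (fun v : ℝ => Φ v * (2 * Real.pi * Complex.I * v)) :=
    hΦs.mul (contDiff_const.mul Complex.ofRealCLM.contDiff)
  obtain ⟨C, hC, hK⟩ := norm_expKernel_le_div (contDiff_infty.1 hΦs 2) hsupp
  obtain ⟨C', hC', hK'⟩ := norm_expKernel_le_div (contDiff_infty.1 hΦs' 2) hsupp'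
  rw [hra] at hK hK'
  have hd := hasDerivAt_expKernel hΦs.continuous hsupp
  have hK'c : Continuous (expKernel fun v : ℝ => Φ v * (2 * Real.pi * Complex.I * v)) :=
    continuous_iff_continuousAt.2 fun z =>
      (hasDerivAt_expKernel hΦs'.continuous hsupp' z).continuousAt
  have hdiff := differentiable_integral_mul_kernel_sub hx hM hC hC'
    (hΩ.trans ha).le hK hK' hd hK'c
  refine ⟨_, hdiff, ⟨_, norm_integral_mul_kernel_sub_le hM hC hK⟩, fun t => ?_⟩
  refine (eq_integral_mul_expKernel_of_gap hx hM hgap hΦs.continuous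
    (hΦs.continuous.integrable_of_hasCompactSupport hcs)
    (𝓕 (hcs.toSchwartzMap hΦs)).integrable (fun ω hω => ?_)
    (hdiff.continuous.comp Complex.continuous_ofReal) t).symm
  have : b (ω / (2 * Real.pi)) = 1 := by
    apply b.one_of_mem_closedBall
    rw [mem_closedBall_zero_iff, Real.norm_eq_abs, abs_div, abs_of_pos hpi]
    have := (abs_lt.2 hω).le
    change _ ≤ Ω / (2 * Real.pi)
    gcongr
  simp [hΦ, this]

theorem corollary1 (Ω : ℝ) (hΩ_pos : 0 < Ω) (hΩ_lt : Ω < Real.pi) (θ : ℝ)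
    (x₁ x₂ : ℝ → ℂ)
    (hx₁_cont : Continuous x₁) (hx₁ : x₁ ∈ bandLimited Ω)
    (hx₂_cont : Continuous x₂) (hx₂ : x₂ ∈ bandLimited Ω)
    (h_sample : ∀ k : ℤ, (k : ℝ) ≤ θ → x₁ (k : ℝ) = x₂ (k : ℝ)) :
    x₁ = x₂ := by
  obtain ⟨M₁, hM₁⟩ := hx₁_cont.norm_le_of_memLp_top hx₁.memLp_top
  obtain ⟨M₂, hM₂⟩ := hx₂_cont.norm_le_of_memLp_top hx₂.memLp_top
  obtain ⟨a, ha, ha'⟩ := exists_between hΩ_lt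
  obtain ⟨f, hf, ⟨C, hC⟩, hfx⟩ := exists_entire_extension_of_gap hΩ_pos ha
    (hx₁_cont.sub hx₂_cont)
    (fun t => (norm_sub_le _ _).trans (add_le_add (hM₁ t) (hM₂ t))) (fun y hy hyω => by
      have hy' : ∀ ω ∈ ((Set.Ioo (-Ω) Ω)ᶜ)ᶜ, angularFourier y ω = 0 := by rwa [compl_compl]
      simp only [sub_mul, Pi.sub_apply]
      rw [integral_sub (hy.bdd_mul hx₁_cont.aestronglyMeasurable (ae_of_all _ hM₁))
        (hy.bdd_mul hx₂_cont.aestronglyMeasurable (ae_of_all _ hM₂)),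
        hx₁.integral_eq_zero y hy hy', hx₂.integral_eq_zero y hy hy', sub_self])
  -- The reflection carries the sample points `k ≤ θ` onto `ℕ` and preserves `|Im z|`.
  have hzero := eq_zero_of_exp_abs_im_of_natCast (f := fun z => f (⌊θ⌋ - z)) (C := C)
    (hΩ_pos.trans ha).le ha' (by fun_prop) (fun z => by simpa using hC (⌊θ⌋ - z)) (fun k => by
      have h1 : ((⌊θ⌋ : ℂ) - k) = (((⌊θ⌋ - k : ℤ) : ℝ) : ℂ) := by push_cast; rfl
      have h2 : ((⌊θ⌋ - k : ℤ) : ℝ) ≤ θ := by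
        push_cast
        have := Int.floor_le θ
        have : (0 : ℝ) ≤ k := by positivity
        linarith
      rw [h1, hfx, Pi.sub_apply, h_sample _ h2, sub_self])
  ext t
  have := congrFun hzero (⌊θ⌋ - t)
  simp only [sub_sub_cancel, Pi.zero_apply, hfx] at this
  exact sub_eq_zero.1 this
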